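/- **Universal property of the enveloping C*-algebra.** *Setting.* A *normed $*$-algebra* is a complex (associative, not necessarily unital) algebra $A$ with an involution $a\mapsto a^*$ (conjugate-linear, anti-multiplicative, $a^{**}=a$) and a norm satisfying $|ab|\le|a||b|$; neither completeness nor continuity of the involution is assumed. Let $A_{sa}=\{a\in A: a^*=a\}$, a real normed space. Put $r_\lambda(a)=\inf_{n\ge1}|a^n|^{1/n}$ and $r_\sigma(a)=r_\lambda(a^*a)^{1/2}$. A linear map $f$ from $A$ to a normed space is *$\sigma$-contractive* if $\|f(a)\|\le r_\sigma(a)$ for all $a\in A$. A *representation* of $A$ in a complex Hilbert space $H$ is an algebra homomorphism $\pi:A\to\mathrm{End}(H)$ with $\langle\pi(a)x,y\rangle=\langle x,\pi(a^*)y\rangle$ for all $a\in A$ and $x,y\in H$ (all $\pi(a)$ are then bounded operators). A linear functional $\varphi$ on $A$ is *positive* if $\varphi(a^*a)\ge0$ for all $a$. It has *finite variation* if there is $v\ge0$ with $|\varphi(a)|^2\le v\,\varphi(a^*a)$ for all $a$; the least such $v$ is its variation $v(\varphi)$. A positive $\varphi$ is *weakly continuous on $A_{sa}$* if for every $b\in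 A$ the map $a\mapsto\varphi(b^*ab)$ is continuous on $A_{sa}$. A *quasi-state* (resp. *state*) on $A$ is a positive linear functional of finite variation, weakly continuous on $A_{sa}$, with $v(\varphi)\le1$ (resp. $v(\varphi)=1$). The set $QS(A)$ of quasi-states is regarded, by restriction to $A_{sa}$, as a subset of the dual of the real normed space $A_{sa}$, and carries the weak* topology; the set $S(A)\subset QS(A)$ of states carries the subspace topology. Put $\|a\|_o=\sup_{\psi\in S(A)}\psi(a^*a)^{1/2}$ ($:=0$ if $S(A)=\emptyset$). This is a finite seminorm, and the quotient of $A$ by the ideal $\{a:\|a\|_o=0\}$ with the norm induced by $\|\cdot\|_o$ is a $*$-algebra whose norm satisfies the C*-identity; its completion is the *enveloping C\*-algebra* $C^*(A)$, and $j:A\to C^*(A)$ denotes the canonical $*$-homomorphism. *Theorem.* Let $A$ be a normed $*$-algebra. 1. For every complex Hilbert space $H$, the assignment $\pi_o\mapsto\pi_o\circ j$ is a bijection from the set of all representations of $C^*(A)$ in $H$ onto the set of all $\sigma$-contractive representations of $A$ in $H$. 2. The assignment $\varphi_o\mapsto\varphi_o\circ j$ is a bijection from the set of all positive linear functionals on $C^*(A)$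 onto the set of all positive linear functionals of finite variation on $A$ that are weakly continuous on $A_{sa}$. Moreover, every positive linear functional $\varphi_o$ on $C^*(A)$ has finite variation, and $v(\varphi_o\circ j)=v(\varphi_o)$. 3. The sets $QS(C^*(A))$, $QS(A)$, $S(C^*(A))$ and $S(A)$ are convex, and the assignment $\varphi_o\mapsto\varphi_o\circ j$ is an affine homeomorphism from $QS(C^*(A))$ onto $QS(A)$, which restricts to an affine homeomorphism from $S(C^*(A))$ onto $S(A)$. -/

import Mathlib

open scoped ComplexOrder

universe u v

namespace EnvCStar

noncomputable section

section Functionals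

variable {A : Type u} [NonUnitalNormedRing A] [StarRing A] [NormedSpace ℂ A]

/-- Positivity of a linear functional: `φ (a⋆ a) ≥ 0` for all `a`
(in particular `φ (a⋆ a)` is real). -/
def IsPositive (φ : A →ₗ[ℂ] ℂ) : Prop := ∀ a : A, 0 ≤ φ (star a * a)

/-- For every `b`, the functional `a ↦ φ (b⋆ a b)` is continuous on the real subspace of
self-adjoint elements, with the topology of the norm of `A`. -/
def WeaklyContinuousOnSA (φ : A →ₗ[ℂ] ℂ) : Prop :=
  ∀ b : A, Continuous fun h : selfAdjoint A => φ (star b * (h : A) * b)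

/-- The constants `v ≥ 0` with `|φ a| ^ 2 ≤ v φ (a⋆ a)` for all `a`. -/
def variationBounds (φ : A →ₗ[ℂ] ℂ) : Set ℝ :=
  {v : ℝ | 0 ≤ v ∧ ∀ a : A, ‖φ a‖ ^ 2 ≤ v * (φ (star a * a)).re}

def HasFiniteVariation (φ : A →ₗ[ℂ] ℂ) : Prop := (variationBounds φ).Nonempty

/-- The variation of `φ` (meaningful if `φ` has finite variation). -/
def variation (φ : A →ₗ[ℂ] ℂ) : ℝ := sInf (variationBounds φ)

structure IsState (φ : A →ₗ[ℂ] ℂ) : Prop where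
  positive : IsPositive φ
  weaklyContinuous : WeaklyContinuousOnSA φ
  finiteVariation : HasFiniteVariation φ
  variation_eq_one : variation φ = 1

structure IsQuasiState (φ : A →ₗ[ℂ] ℂ) : Prop where
  positive : IsPositive φ
  weaklyContinuous : WeaklyContinuousOnSA φ
  finiteVariation : HasFiniteVariation φ
  variation_le_one : variation φ ≤ 1

variable (A) in
/-- The set `S(A)` of states, as a type. -/
def State : Type u := {φ : A →ₗ[ℂ] ℂ // IsState φ}

variable (A) in
/-- The set `QS(A)` of quasi-states, as a type. -/
def QuasiState : Type u := {φ : A →ₗ[ℂ] ℂ // IsQuasiState φ}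

/-- The Gelfand–Naimark seminorm `‖a‖ₒ = sup_ψ ψ (a⋆ a) ^ (1/2)` over all states `ψ`; it is `0` if
there are no states. The supremum is finite, see `bddAbove_gn`. -/
def gnSeminorm (a : A) : ℝ := ⨆ ψ : State A, √(ψ.1 (star a * a)).re

/-- `r_λ(a) = inf_{n ≥ 1} ‖a ^ n‖ ^ (1 / n)`; here `(a * ·)^[n] a = a ^ (n + 1)`. -/
def rLambda (a : A) : ℝ := ⨅ n : ℕ, ‖(fun x : A => a * x)^[n] a‖ ^ ((1 : ℝ) / (n + 1))

/-- The Pták function `r_σ(a) = r_λ(a⋆ a) ^ (1/2)`. -/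
def rSigma (a : A) : ℝ := √(rLambda (star a * a))

/-- A linear map `f` into a normed space with `‖f a‖ ≤ r_σ(a)` for all `a`. -/
def IsSigmaContractive {E : Type*} [NormedAddCommGroup E] [NormedSpace ℂ E] (f : A →ₗ[ℂ] E) :
    Prop := ∀ a : A, ‖f a‖ ≤ rSigma a

end Functionals

section Representations

/-- A representation of the `*`-algebra `A` in the pre-Hilbert space `H`. -/
structure StarRep (A : Type*) [NonUnitalNormedRing A] [StarRing A] [NormedSpace ℂ A]
    (H : Type*) [NormedAddCommGroup H] [InnerProductSpace ℂ H]
    extends A →ₙₐ[ℂ] Module.End ℂ H where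
  inner_left : ∀ (a : A) (x y : H), inner ℂ (toFun a x) y = inner ℂ x (toFun (star a) y)

variable {A : Type*} [NonUnitalNormedRing A] [StarRing A] [NormedSpace ℂ A]
  {B : Type*} [NonUnitalNormedRing B] [StarRing B] [NormedSpace ℂ B]
  {H : Type*} [NormedAddCommGroup H] [InnerProductSpace ℂ H]

/-- The representation `π ∘ f`. -/
def StarRep.comp (π : StarRep B H) (f : A →⋆ₙₐ[ℂ] B) : StarRep A H where
  toNonUnitalAlgHom := π.toNonUnitalAlgHom.comp f.toNonUnitalAlgHom
  inner_left a x y := by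
    have h := π.inner_left (f a) x y
    rw [← map_star] at h
    exact h

/-- Hellinger–Toeplitz: the operators of a representation in a Hilbert space are bounded. -/
theorem StarRep.continuous_apply [CompleteSpace H] (π : StarRep A H) (a : A) :
    Continuous (π.toFun a) := by
  refine (π.toFun a).continuous_of_seq_closed_graph fun u x y hu hy => ?_
  rw [← sub_eq_zero, ← inner_self_eq_zero (𝕜 := ℂ)]
  set z := y - π.toFun a x with hz
  have h1 : Filter.Tendsto (fun n => inner ℂ (π.toFun a (u n)) z) Filter.atTop
      (nhds (inner ℂ y z)) := Filter.Tendsto.inner hy tendsto_const_nhds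
  have h2 : Filter.Tendsto (fun n => inner ℂ (π.toFun a (u n)) z) Filter.atTop
      (nhds (inner ℂ (π.toFun a x) z)) := by
    simp only [π.inner_left]
    exact Filter.Tendsto.inner hu tendsto_const_nhds
  have h3 := tendsto_nhds_unique h1 h2
  rw [hz, inner_sub_left, ← hz, h3, sub_self]

/-- A representation in a Hilbert space as a linear map into the bounded operators. -/
def StarRep.op [CompleteSpace H] (π : StarRep A H) : A →ₗ[ℂ] (H →L[ℂ] H) where
  toFun a := ⟨π.toFun a, π.continuous_apply a⟩
  map_add' a b := by
    ext x
    exact congrArg (fun T : Module.End ℂ H => T x) (π.map_add' a b)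
  map_smul' c a := by
    ext x
    exact congrArg (fun T : Module.End ℂ H => T x) (π.map_smul' c a)

end Representations


section Seminorm

variable {A : Type u} [NonUnitalNormedRing A] [StarRing A] [NormedSpace ℂ A]

theorem mem_variationBounds {φ : A →ₗ[ℂ] ℂ} (hp : IsPositive φ) (hf : HasFiniteVariation φ) :
    variation φ ∈ variationBounds φ := by
  have h0 : 0 ≤ variation φ := Real.sInf_nonneg fun v hv => hv.1
  refine ⟨h0, fun a => ?_⟩
  have hre : 0 ≤ (φ (star a * a)).re := (Complex.le_def.1 (hp a)).1
  rcases hre.eq_or_lt with h | h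
  · obtain ⟨v, hv⟩ := hf
    have := hv.2 a
    rw [← h] at this ⊢
    simpa using this
  · rw [← div_le_iff₀ h]
    exact le_csInf hf fun v hv => (div_le_iff₀ h).2 (hv.2 a)

variable [IsScalarTower ℂ A A] [SMulCommClass ℂ A A] [StarModule ℂ A]

theorem form_symm {φ : A →ₗ[ℂ] ℂ} (hp : IsPositive φ) (a b : A) :
    (starRingEnd ℂ) (φ (star b * a)) = φ (star a * b) := by
  have h1 := (Complex.le_def.1 (hp (a + b))).2
  have h2 := (Complex.le_def.1 (hp (a + Complex.I • b))).2
  have ha := (Complex.le_def.1 (hp a)).2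
  have hb := (Complex.le_def.1 (hp b)).2
  simp only [star_add, star_smul, mul_add, add_mul, map_add, smul_mul_assoc, mul_smul_comm,
    map_smul, smul_eq_mul, Complex.add_im, Complex.mul_im, Complex.mul_re, Complex.zero_im,
    RCLike.star_def, Complex.conj_I, Complex.neg_re, Complex.neg_im, Complex.I_re,
    Complex.I_im] at h1 h2 ha hb
  apply Complex.ext
  · simp only [Complex.conj_re]; linarith
  · simp only [Complex.conj_im]; linarith

/-- The semi-inner product `(a, b) ↦ φ (a⋆ b)`. -/
@[reducible] def formCore {φ : A →ₗ[ℂ] ℂ} (hp : IsPositive φ) : PreInnerProductSpace.Core ℂ A where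
  inner a b := φ (star a * b)
  conj_inner_symm a b := form_symm hp a b
  re_inner_nonneg a := (Complex.le_def.1 (hp a)).1
  add_left a b c := by simp [add_mul]
  smul_left a b c := by
    rw [star_smul, smul_mul_assoc, map_smul]
    rfl

theorem form_cauchySchwarz {φ : A →ₗ[ℂ] ℂ} (hp : IsPositive φ) (a b : A) :
    ‖φ (star a * b)‖ ^ 2 ≤ (φ (star a * a)).re * (φ (star b * b)).re := by
  let _ := formCore hp
  have h := InnerProductSpace.Core.inner_mul_inner_self_le (𝕜 := ℂ) (F := A) a b
  have h' : ‖φ (star a * b)‖ * ‖φ (star b * a)‖ ≤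
    (φ (star a * a)).re * (φ (star b * b)).re := h
  have e : ‖φ (star b * a)‖ = ‖φ (star a * b)‖ := by
    rw [← form_symm hp a b, RCLike.norm_conj]
  rw [e] at h'
  rw [sq]; exact h'

theorem form_add_le {φ : A →ₗ[ℂ] ℂ} (hp : IsPositive φ) (a b : A) :
    √(φ (star (a + b) * (a + b))).re ≤ √(φ (star a * a)).re + √(φ (star b * b)).re := by
  have ha : 0 ≤ (φ (star a * a)).re := (Complex.le_def.1 (hp a)).1
  have hb : 0 ≤ (φ (star b * b)).re := (Complex.le_def.1 (hp b)).1
  apply Real.sqrt_le_iff.2 ⟨by positivity, ?_⟩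
  have h := form_cauchySchwarz hp a b
  have h1 : (φ (star a * b)).re ≤ √(φ (star a * a)).re * √(φ (star b * b)).re := by
    rw [← Real.sqrt_mul ha]
    exact (Complex.re_le_norm _).trans (Real.le_sqrt_of_sq_le h)
  have h2 : (φ (star b * a)).re = (φ (star a * b)).re := by
    rw [← form_symm hp a b, Complex.conj_re]
  rw [add_sq, Real.sq_sqrt ha, Real.sq_sqrt hb]
  simp only [star_add, mul_add, add_mul, map_add, Complex.add_re]
  linarith

/-- The functional `x ↦ φ (b⋆ x b)`. -/
def conjFunctional (φ : A →ₗ[ℂ] ℂ) (b : A) : A →ₗ[ℂ] ℂ where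
  toFun x := φ (star b * x * b)
  map_add' x y := by simp [mul_add, add_mul]
  map_smul' c x := by
    rw [mul_smul_comm, smul_mul_assoc, map_smul]
    rfl

theorem conjFunctional_positive {φ : A →ₗ[ℂ] ℂ} (hp : IsPositive φ) (b : A) :
    IsPositive (conjFunctional φ b) := fun a => by
  have := hp (a * b)
  simpa [conjFunctional, mul_assoc] using this

theorem conjFunctional_mem {φ : A →ₗ[ℂ] ℂ} (hp : IsPositive φ) (b : A) :
    (φ (star b * b)).re ∈ variationBounds (conjFunctional φ b) :=
  ⟨(Complex.le_def.1 (hp b)).1, fun a => by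
    have := form_cauchySchwarz hp b (a * b)
    simpa [conjFunctional, mul_assoc] using this⟩

theorem conjFunctional_weaklyContinuous {φ : A →ₗ[ℂ] ℂ} (hw : WeaklyContinuousOnSA φ) (b : A) :
    WeaklyContinuousOnSA (conjFunctional φ b) := fun c => by
  simpa [conjFunctional, mul_assoc] using hw (c * b)

/-- A functional of variation at most `v` that is continuous on `A_sa` is bounded by `v` there. -/
theorem norm_le_of_continuous {φ : A →ₗ[ℂ] ℂ} {v : ℝ} (hv : v ∈ variationBounds φ)
    (hc : Continuous fun h : selfAdjoint A => φ h) (h : A) (hh : IsSelfAdjoint h) :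
    ‖φ h‖ ≤ v * ‖h‖ := by
  let V := selfAdjoint.submodule ℝ A
  let F : V →L[ℝ] ℂ := ⟨(φ.restrictScalars ℝ).comp V.subtype, hc⟩
  have key : ∀ k : V, ‖F k‖ ≤ √(v * ‖F‖) * ‖k‖ := fun k => by
    have hk : star (k : A) = k := k.2
    let k2 : V := ⟨(k : A) * k, by
      show star ((k : A) * k) = k * k
      rw [star_mul, hk]⟩
    have h1 : ‖F k‖ ^ 2 ≤ v * (φ ((k : A) * k)).re := by
      have := hv.2 k
      rwa [hk] at this
    have h2 : (φ ((k : A) * k)).re ≤ ‖F‖ * (‖k‖ * ‖k‖) :=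
      (Complex.re_le_norm _).trans ((F.le_opNorm k2).trans
        (mul_le_mul_of_nonneg_left (norm_mul_le (k : A) k) (norm_nonneg _)))
    have h3 : ‖F k‖ ^ 2 ≤ (√(v * ‖F‖) * ‖k‖) ^ 2 := by
      rw [mul_pow, Real.sq_sqrt (mul_nonneg hv.1 (norm_nonneg F))]
      calc _ ≤ _ := h1
        _ ≤ v * (‖F‖ * (‖k‖ * ‖k‖)) := mul_le_mul_of_nonneg_left h2 hv.1
        _ = _ := by ring
    exact le_of_sq_le_sq h3 (by positivity)
  have h4 : ‖F‖ ≤ √(v * ‖F‖) := F.opNorm_le_bound (Real.sqrt_nonneg _) key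
  have h5 : ‖F‖ ≤ v := by
    rcases (norm_nonneg F).eq_or_lt with h0 | h0
    · rw [← h0]; exact hv.1
    · have := (Real.le_sqrt' h0).1 h4
      nlinarith
  exact (F.le_opNorm (⟨h, hh⟩ : V)).trans (mul_le_mul_of_nonneg_right h5 (norm_nonneg _))

theorem form_le_of_isSelfAdjoint {φ : A →ₗ[ℂ] ℂ} (hp : IsPositive φ)
    (hw : WeaklyContinuousOnSA φ) {v : ℝ} (hv : v ∈ variationBounds φ) (h : A)
    (hh : IsSelfAdjoint h) : (φ (h * h)).re ≤ v * (‖h‖ * ‖h‖) := by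
  have hs : star h = h := hh
  have hh2 : IsSelfAdjoint (h * h) := by
    show star (h * h) = h * h
    rw [star_mul, hs]
  have h1 := norm_le_of_continuous (conjFunctional_mem hp h) (hw h) (h * h) hh2
  have h2 := hv.2 (h * h)
  have e : star (h * h) * (h * h) = star h * (h * h) * h := by
    rw [star_mul, hs]; simp only [mul_assoc]
  have h3 : ((conjFunctional φ h) (h * h)).re ≤ _ := (Complex.re_le_norm _).trans h1
  have e' : (conjFunctional φ h) (h * h) = φ (star (h * h) * (h * h)) := by
    rw [e]; rfl
  rw [e', hs] at h3
  have hpos : 0 ≤ (φ (h * h)).re := by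
    have := (Complex.le_def.1 (hp h)).1
    rwa [hs] at this
  have h4 : (φ (h * h)).re ^ 2 ≤ v * ((φ (h * h)).re * (‖h‖ * ‖h‖)) := by
    calc (φ (h * h)).re ^ 2 ≤ ‖φ (h * h)‖ ^ 2 :=
          pow_le_pow_left₀ hpos (Complex.re_le_norm _) 2
      _ ≤ _ := h2
      _ ≤ _ := mul_le_mul_of_nonneg_left
        (h3.trans (mul_le_mul_of_nonneg_left (norm_mul_le h h) hpos)) hv.1
  rcases hpos.eq_or_lt with h0 | h0
  · rw [← h0]; have := hv.1; positivity
  · have : (φ (h * h)).re * (φ (h * h)).re ≤ (φ (h * h)).re * (v * (‖h‖ * ‖h‖)) := by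
      nlinarith
    exact le_of_mul_le_mul_left this h0

theorem norm_le_of_isSelfAdjoint {φ : A →ₗ[ℂ] ℂ} (hp : IsPositive φ)
    (hw : WeaklyContinuousOnSA φ) {v : ℝ} (hv : v ∈ variationBounds φ) (h : A)
    (hh : IsSelfAdjoint h) : ‖φ h‖ ≤ v * ‖h‖ := by
  have h1 := hv.2 h
  rw [show star h = h from hh] at h1
  have h2 := form_le_of_isSelfAdjoint hp hw hv h hh
  refine le_of_sq_le_sq ?_ (mul_nonneg hv.1 (norm_nonneg _))
  calc _ ≤ _ := h1
    _ ≤ v * (v * (‖h‖ * ‖h‖)) := mul_le_mul_of_nonneg_left h2 hv.1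
    _ = _ := by ring

theorem State.mem_variationBounds (ψ : State A) : 1 ∈ variationBounds ψ.1 := by
  have := EnvCStar.mem_variationBounds ψ.2.positive ψ.2.finiteVariation
  rwa [ψ.2.variation_eq_one] at this

theorem State.form_nonneg (ψ : State A) (a : A) : 0 ≤ (ψ.1 (star a * a)).re :=
  (Complex.le_def.1 (ψ.2.positive a)).1

theorem bddAbove_gn (a : A) :
    BddAbove (Set.range fun ψ : State A => √(ψ.1 (star a * a)).re) := by
  refine ⟨√‖star a * a‖, ?_⟩
  rintro _ ⟨ψ, rfl⟩
  apply Real.sqrt_le_sqrt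
  have := norm_le_of_isSelfAdjoint ψ.2.positive ψ.2.weaklyContinuous ψ.mem_variationBounds
    (star a * a) (IsSelfAdjoint.star_mul_self a)
  rw [one_mul] at this
  exact (Complex.re_le_norm _).trans this

theorem gn_nonneg (a : A) : 0 ≤ gnSeminorm a := Real.iSup_nonneg fun _ => Real.sqrt_nonneg _

theorem le_gn (ψ : State A) (a : A) : √(ψ.1 (star a * a)).re ≤ gnSeminorm a :=
  le_ciSup (bddAbove_gn a) ψ

theorem re_le_gn_sq (ψ : State A) (a : A) : (ψ.1 (star a * a)).re ≤ gnSeminorm a ^ 2 :=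
  (Real.sqrt_le_left (gn_nonneg a)).1 (le_gn ψ a)

theorem gn_le {a : A} {c : ℝ} (hc : 0 ≤ c)
    (h : ∀ ψ : State A, (ψ.1 (star a * a)).re ≤ c ^ 2) : gnSeminorm a ≤ c :=
  Real.iSup_le (fun ψ => (Real.sqrt_le_left hc).2 (h ψ)) hc

theorem gn_add_le (a b : A) : gnSeminorm (a + b) ≤ gnSeminorm a + gnSeminorm b :=
  Real.iSup_le (fun ψ => (form_add_le ψ.2.positive a b).trans
    (add_le_add (le_gn ψ a) (le_gn ψ b))) (add_nonneg (gn_nonneg a) (gn_nonneg b))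

theorem gn_smul (c : ℂ) (a : A) : gnSeminorm (c • a) = ‖c‖ * gnSeminorm a := by
  unfold gnSeminorm
  rw [Real.mul_iSup_of_nonneg (norm_nonneg c)]
  congr 1
  ext ψ
  have : (ψ.1 (star (c • a) * (c • a))).re = ‖c‖ ^ 2 * (ψ.1 (star a * a)).re := by
    rw [star_smul, smul_mul_assoc, mul_smul_comm, smul_smul, map_smul, RCLike.star_def,
      ← Complex.normSq_eq_conj_mul_self, smul_eq_mul, Complex.re_ofReal_mul, Complex.normSq_eq_norm_sq]
  rw [this, Real.sqrt_mul (by positivity), Real.sqrt_sq (norm_nonneg c)]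

theorem gn_zero : gnSeminorm (0 : A) = 0 := by simpa using gn_smul (0 : ℂ) (0 : A)

theorem gn_neg (a : A) : gnSeminorm (-a) = gnSeminorm a := by simpa using gn_smul (-1 : ℂ) a

/-- `φ (a⋆ a) ≤ v ‖a‖ₒ²` for `φ` weakly continuous on `A_sa` with variation bound `v`. -/
theorem form_le_gn {φ : A →ₗ[ℂ] ℂ} (hp : IsPositive φ) (hw : WeaklyContinuousOnSA φ) {v : ℝ}
    (hv : v ∈ variationBounds φ) (a : A) :
    (φ (star a * a)).re ≤ v * gnSeminorm a ^ 2 := by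
  have hf : HasFiniteVariation φ := ⟨v, hv⟩
  have hm := mem_variationBounds hp hf
  have hle : variation φ ≤ v := csInf_le ⟨0, fun w hw => hw.1⟩ hv
  refine le_trans ?_ (mul_le_mul_of_nonneg_right hle (sq_nonneg _))
  rcases hm.1.eq_or_lt with h0 | h0
  · have h1 := hm.2 (star a * a)
    rw [← h0, zero_mul] at h1 ⊢
    have h2 : ‖φ (star a * a)‖ = 0 := by
      have := sq_nonneg ‖φ (star a * a)‖
      exact pow_eq_zero_iff (two_ne_zero) |>.1 (le_antisymm h1 this)
    exact (Complex.re_le_norm _).trans h2.le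
  · set w := variation φ with hwdef
    have happ : ∀ x, ((((w⁻¹ : ℝ) : ℂ) • φ) x) = ((w⁻¹ : ℝ) : ℂ) * φ x := fun x => rfl
    have hb : ∀ r : ℝ, r ∈ variationBounds (((w⁻¹ : ℝ) : ℂ) • φ) ↔ w * r ∈ variationBounds φ := by
      intro r
      have e1 : 0 ≤ r ↔ 0 ≤ w * r := (mul_nonneg_iff_of_pos_left h0).symm
      refine and_congr e1 (forall_congr' fun x => ?_)
      rw [happ, happ, Complex.re_ofReal_mul, norm_mul, Complex.norm_real, Real.norm_of_nonneg
        (inv_nonneg.2 h0.le), mul_pow]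
      have e2 : w⁻¹ ^ 2 * ‖φ x‖ ^ 2 = ‖φ x‖ ^ 2 / w ^ 2 := by field_simp
      have e3 : r * (w⁻¹ * (φ (star x * x)).re) = w * r * (φ (star x * x)).re / w ^ 2 := by
        field_simp
      rw [e2, e3, div_le_div_iff_of_pos_right (by positivity)]
    let ψ : State A := ⟨((w⁻¹ : ℝ) : ℂ) • φ, by
      refine ⟨fun x => ?_, fun b => ?_, ⟨1, (hb 1).2 (by rwa [mul_one])⟩, ?_⟩
      · rw [happ]
        exact mul_nonneg (by exact_mod_cast (inv_nonneg.2 h0.le)) (hp x)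
      · simp only [happ]
        exact continuous_const.mul (hw b)
      · refine le_antisymm (csInf_le ⟨0, fun r hr => hr.1⟩ ((hb 1).2 (by rwa [mul_one]))) ?_
        refine le_csInf ⟨1, (hb 1).2 (by rwa [mul_one])⟩ fun r hr => ?_
        have h3 : w ≤ w * r := csInf_le ⟨0, fun r hr => hr.1⟩ ((hb r).1 hr)
        exact le_of_mul_le_mul_left (by rwa [mul_one]) h0⟩
    have h4 := re_le_gn_sq ψ a
    have h5 : (ψ.1 (star a * a)).re = w⁻¹ * (φ (star a * a)).re := by
      show ((((w⁻¹ : ℝ) : ℂ) • φ) (star a * a)).re = _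
      rw [happ, Complex.re_ofReal_mul]
    rw [h5, inv_mul_le_iff₀ h0] at h4
    exact h4

theorem gn_mul_le (a b : A) : gnSeminorm (a * b) ≤ gnSeminorm a * gnSeminorm b := by
  refine gn_le (mul_nonneg (gn_nonneg a) (gn_nonneg b)) fun ψ => ?_
  have h1 := form_le_gn (conjFunctional_positive ψ.2.positive b)
    (conjFunctional_weaklyContinuous ψ.2.weaklyContinuous b)
    (conjFunctional_mem ψ.2.positive b) a
  have e : conjFunctional ψ.1 b (star a * a) = ψ.1 (star (a * b) * (a * b)) := by
    simp [conjFunctional, mul_assoc]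
  rw [e] at h1
  calc _ ≤ _ := h1
    _ ≤ gnSeminorm b ^ 2 * gnSeminorm a ^ 2 :=
      mul_le_mul_of_nonneg_right (re_le_gn_sq ψ b) (sq_nonneg _)
    _ = _ := by ring

theorem gn_sq_le (a : A) : gnSeminorm a ^ 2 ≤ gnSeminorm (star a * a) := by
  have h : gnSeminorm a ≤ √(gnSeminorm (star a * a)) := by
    refine gn_le (Real.sqrt_nonneg _) fun ψ => ?_
    rw [Real.sq_sqrt (gn_nonneg _)]
    refine le_trans ?_ (le_gn ψ (star a * a))
    refine Real.le_sqrt_of_sq_le ?_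
    have := ψ.mem_variationBounds.2 (star a * a)
    rw [one_mul] at this
    exact (pow_le_pow_left₀ (ψ.form_nonneg a) (Complex.re_le_norm _) 2).trans this
  have := pow_le_pow_left₀ (gn_nonneg a) h 2
  rwa [Real.sq_sqrt (gn_nonneg _)] at this

theorem gn_le_star (a : A) : gnSeminorm a ≤ gnSeminorm (star a) := by
  have h := (gn_sq_le a).trans (gn_mul_le (star a) a)
  rcases (gn_nonneg a).eq_or_lt with h0 | h0
  · rw [← h0]; exact gn_nonneg _
  · rw [sq] at h
    exact le_of_mul_le_mul_right h h0

theorem gn_star (a : A) : gnSeminorm (star a) = gnSeminorm a :=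
  le_antisymm (by simpa using gn_le_star (star a)) (gn_le_star a)

end Seminorm

section Construction

variable (A : Type u) [NonUnitalNormedRing A] [StarRing A] [NormedSpace ℂ A]

/-- The `*`-algebra `A`, regarded as a seminormed `*`-algebra under the Gelfand–Naimark
seminorm. -/
def GNAlgebra : Type u := A

instance : NonUnitalRing (GNAlgebra A) := inferInstanceAs (NonUnitalRing A)
instance : StarRing (GNAlgebra A) := inferInstanceAs (StarRing A)
instance : Module ℂ (GNAlgebra A) := inferInstanceAs (Module ℂ A)

variable [IsScalarTower ℂ A A] [SMulCommClass ℂ A A] [StarModule ℂ A]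

instance : IsScalarTower ℂ (GNAlgebra A) (GNAlgebra A) := inferInstanceAs (IsScalarTower ℂ A A)
instance : SMulCommClass ℂ (GNAlgebra A) (GNAlgebra A) := inferInstanceAs (SMulCommClass ℂ A A)
instance : StarModule ℂ (GNAlgebra A) := inferInstanceAs (StarModule ℂ A)

instance : NonUnitalSeminormedRing (GNAlgebra A) :=
  { (inferInstance : NonUnitalRing (GNAlgebra A)),
    AddGroupSeminorm.toSeminormedAddCommGroup (E := GNAlgebra A)
      { toFun := fun a => gnSeminorm (A := A) a
        map_zero' := gn_zero (A := A)
        add_le' := gn_add_le (A := A)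
        neg' := gn_neg (A := A) } with
    norm_mul_le := gn_mul_le (A := A) }

instance : NormedSpace ℂ (GNAlgebra A) where
  norm_smul_le c a := (gn_smul (A := A) c a).le

instance : NormedStarGroup (GNAlgebra A) where
  norm_star_le a := (gn_star (A := A) a).le

/-- The (Hausdorff) completion of `A` under the Gelfand–Naimark seminorm. -/
abbrev GNCompletion : Type u := UniformSpace.Completion (GNAlgebra A)

namespace GNCompletion

open UniformSpace UniformSpace.Completion

variable {A}

/-- The canonical map from `A` to `C*(A)`, as a function. -/
def ofAlg (a : GNAlgebra A) : GNCompletion A := (a : Completion (GNAlgebra A))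

theorem isDenseInducing_ofAlg : IsDenseInducing (ofAlg (A := A)) :=
  Completion.isDenseInducing_coe

theorem continuous_ofAlg : Continuous (ofAlg (A := A)) := isDenseInducing_ofAlg.continuous

theorem norm_ofAlg (a : GNAlgebra A) : ‖ofAlg a‖ = ‖a‖ := Completion.norm_coe a

theorem ofAlg_add (a b : GNAlgebra A) : ofAlg (a + b) = ofAlg a + ofAlg b := Completion.coe_add a b

theorem ofAlg_smul (c : ℂ) (a : GNAlgebra A) : ofAlg (c • a) = c • ofAlg a :=
  Completion.coe_smul c a

theorem ofAlg_zero : ofAlg (0 : GNAlgebra A) = 0 := Completion.coe_zero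

/-- Multiplication, extended by continuity. -/
instance : Mul (GNCompletion A) :=
  ⟨fun x y => (isDenseInducing_ofAlg.prodMap isDenseInducing_ofAlg).extend
    (fun p : GNAlgebra A × GNAlgebra A => ofAlg (p.1 * p.2)) (x, y)⟩

/-- The involution, extended by continuity. -/
instance : Star (GNCompletion A) :=
  ⟨Completion.map (star : GNAlgebra A → GNAlgebra A)⟩

theorem ofAlg_mul (a b : GNAlgebra A) : ofAlg (a * b) = ofAlg a * ofAlg b :=
  ((isDenseInducing_ofAlg.prodMap isDenseInducing_ofAlg).extend_eq
    (continuous_ofAlg.comp continuous_mul) (a, b)).symm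

theorem ofAlg_star (a : GNAlgebra A) : ofAlg (star a) = star (ofAlg a) :=
  (Completion.map_coe (starNormedAddGroupHom (E := GNAlgebra A)).uniformContinuous a).symm

instance : ContinuousMul (GNCompletion A) where
  continuous_mul := by
    let j : GNAlgebra A →+ GNCompletion A := ⟨⟨ofAlg, ofAlg_zero⟩, ofAlg_add⟩
    let m := (AddMonoidHom.mul : GNAlgebra A →+ GNAlgebra A →+ GNAlgebra A).compr₂ j
    have hm : Continuous fun p : GNAlgebra A × GNAlgebra A => m p.1 p.2 :=
      continuous_ofAlg.comp continuous_mul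
    have di : IsDenseInducing (j : GNAlgebra A → GNCompletion A) := isDenseInducing_ofAlg
    exact (di.extend_Z_bilin di hm :)

instance : ContinuousStar (GNCompletion A) where
  continuous_star := Completion.continuous_map

@[elab_as_elim]
theorem ind {p : GNCompletion A → Prop} (x : GNCompletion A) (hp : IsClosed {x | p x})
    (h : ∀ a, p (ofAlg a)) : p x := Completion.induction_on x hp h

@[elab_as_elim]
theorem ind₂ {p : GNCompletion A → GNCompletion A → Prop} (x y : GNCompletion A)
    (hp : IsClosed {q : GNCompletion A × GNCompletion A | p q.1 q.2})
    (h : ∀ a b, p (ofAlg a) (ofAlg b)) : p x y := Completion.induction_on₂ x y hp h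

@[elab_as_elim]
theorem ind₃ {p : GNCompletion A → GNCompletion A → GNCompletion A → Prop} (x y z : GNCompletion A)
    (hp : IsClosed {q : GNCompletion A × GNCompletion A × GNCompletion A | p q.1 q.2.1 q.2.2})
    (h : ∀ a b c, p (ofAlg a) (ofAlg b) (ofAlg c)) : p x y z := Completion.induction_on₃ x y z hp h

instance : NonUnitalNormedRing (GNCompletion A) :=
  { (inferInstance : NormedAddCommGroup (GNCompletion A)), (inferInstance : Mul (GNCompletion A)) with
    zero_mul x := ind x (isClosed_eq (by fun_prop) (by fun_prop)) fun a => by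
      rw [← ofAlg_zero, ← ofAlg_mul, zero_mul]
    mul_zero x := ind x (isClosed_eq (by fun_prop) (by fun_prop)) fun a => by
      rw [← ofAlg_zero, ← ofAlg_mul, mul_zero]
    mul_assoc x y z := ind₃ x y z (isClosed_eq (by fun_prop) (by fun_prop)) fun a b c => by
      simp only [← ofAlg_mul, mul_assoc]
    left_distrib x y z := ind₃ x y z (isClosed_eq (by fun_prop) (by fun_prop)) fun a b c => by
      simp only [← ofAlg_mul, ← ofAlg_add, mul_add]
    right_distrib x y z := ind₃ x y z (isClosed_eq (by fun_prop) (by fun_prop)) fun a b c => by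
      simp only [← ofAlg_mul, ← ofAlg_add, add_mul]
    norm_mul_le x y := ind₂ x y (isClosed_le (by fun_prop) (by fun_prop)) fun a b => by
      rw [← ofAlg_mul, norm_ofAlg, norm_ofAlg, norm_ofAlg]
      exact norm_mul_le a b }

instance : StarRing (GNCompletion A) where
  star_involutive x := ind x (isClosed_eq (by fun_prop) (by fun_prop)) fun a => by
    rw [← ofAlg_star, ← ofAlg_star, star_star]
  star_mul x y := ind₂ x y (isClosed_eq (by fun_prop) (by fun_prop)) fun a b => by
    simp only [← ofAlg_star, ← ofAlg_mul, star_mul]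
  star_add x y := ind₂ x y (isClosed_eq (by fun_prop) (by fun_prop)) fun a b => by
    simp only [← ofAlg_star, ← ofAlg_add, star_add]

instance : IsScalarTower ℂ (GNCompletion A) (GNCompletion A) where
  smul_assoc c x y := ind₂ x y
    (isClosed_eq ((continuous_fst.const_smul c).mul continuous_snd)
      ((continuous_fst.mul continuous_snd).const_smul c)) fun a b => by
      rw [smul_eq_mul, smul_eq_mul, ← ofAlg_smul, ← ofAlg_mul, ← ofAlg_mul, ← ofAlg_smul,
        smul_mul_assoc]

instance : SMulCommClass ℂ (GNCompletion A) (GNCompletion A) where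
  smul_comm c x y := ind₂ x y
    (isClosed_eq ((continuous_fst.mul continuous_snd).const_smul c)
      (continuous_fst.mul (continuous_snd.const_smul c))) fun a b => by
      rw [smul_eq_mul, smul_eq_mul, ← ofAlg_smul, ← ofAlg_mul, ← ofAlg_mul, ← ofAlg_smul,
        mul_smul_comm]

instance : StarModule ℂ (GNCompletion A) where
  star_smul c x := ind x
    (isClosed_eq (continuous_id.const_smul c).star (continuous_id.star.const_smul (star c)))
    fun a => by
      show star (c • ofAlg a) = star c • star (ofAlg a)
      rw [← ofAlg_smul, ← ofAlg_star, ← ofAlg_star, ← ofAlg_smul, star_smul]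

instance : CStarRing (GNCompletion A) where
  norm_mul_self_le x := ind x (isClosed_le (by fun_prop) (by fun_prop)) fun a => by
    rw [← ofAlg_star, ← ofAlg_mul, norm_ofAlg, norm_ofAlg, ← sq]
    exact gn_sq_le (A := A) a

instance : NonUnitalCStarAlgebra (GNCompletion A) where
  complete := CompleteSpace.complete
  norm_smul_le := norm_smul_le

end GNCompletion

/-- The enveloping C⋆-algebra `C*(A)`: the (Hausdorff) completion of `A` under the
Gelfand–Naimark seminorm, i.e. the completion of the quotient of `A` by the `*`-radical
`{a | ‖a‖ₒ = 0}` with the induced norm. -/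
def CStarEnv : Type u := GNCompletion A

instance : NonUnitalCStarAlgebra (CStarEnv A) :=
  inferInstanceAs (NonUnitalCStarAlgebra (GNCompletion A))

/-- The canonical `*`-algebra homomorphism `j : A → C*(A)`. -/
def toCStarEnv : A →⋆ₙₐ[ℂ] CStarEnv A where
  toFun a := GNCompletion.ofAlg (a : GNAlgebra A)
  map_smul' c a := GNCompletion.ofAlg_smul (A := A) c a
  map_zero' := GNCompletion.ofAlg_zero
  map_add' a b := GNCompletion.ofAlg_add (A := A) a b
  map_mul' a b := GNCompletion.ofAlg_mul (A := A) a b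
  map_star' a := GNCompletion.ofAlg_star (A := A) a

theorem norm_toCStarEnv (a : A) : ‖toCStarEnv A a‖ = gnSeminorm a :=
  GNCompletion.norm_ofAlg (A := A) a

theorem denseRange_toCStarEnv : DenseRange (toCStarEnv A) :=
  GNCompletion.isDenseInducing_ofAlg.dense

end Construction

section StateSpaces

variable {A : Type u} [NonUnitalNormedRing A] [StarRing A] [NormedSpace ℂ A]
  [IsScalarTower ℂ A A] [SMulCommClass ℂ A A] [StarModule ℂ A]

/-- The element of the dual of the real normed space `A_sa` given by a quasi-state. (Quasi-states
are Hermitian, so they are real on `A_sa`, and they are determined by their values there.) -/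
def QuasiState.toWeakDual (φ : QuasiState A) : WeakDual ℝ (selfAdjoint A) :=
  StrongDual.toWeakDual
    { toFun := fun h => (φ.1 (h : A)).re
      map_add' := fun h k => by simp
      map_smul' := fun c h => by
        have : φ.1 (c • (h : A)) = (c : ℂ) * φ.1 (h : A) := by
          rw [← Complex.coe_smul, map_smul, smul_eq_mul]
        simp [this]
      cont := by
        refine Complex.continuous_re.comp ?_
        have hv := mem_variationBounds φ.2.positive φ.2.finiteVariation
        refine AddMonoidHomClass.continuous_of_bound
          ((φ.1 : A →+ ℂ).comp (selfAdjoint A).subtype) (variation φ.1) fun h => ?_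
        exact norm_le_of_isSelfAdjoint φ.2.positive φ.2.weaklyContinuous hv h h.2 }

/-- The weak* topology on `QS(A)`. -/
instance : TopologicalSpace (QuasiState A) :=
  TopologicalSpace.induced QuasiState.toWeakDual inferInstance

variable (A) in
/-- `S(A)` as a subset of `QS(A)`. -/
def stateSet : Set (QuasiState A) := {φ | IsState φ.1}

end StateSpaces

end

end EnvCStar

/-!
A `*`-homomorphism `f` into a C⋆-algebra is σ-contractive as soon as `‖f h‖ ≤ ‖h‖` for self-adjoint
`h`: by the C⋆-identity `‖f a‖² = ‖f (a⋆ a)‖`, the norm of a self-adjoint element is its spectral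
radius, and `f` does not increase `r_λ` on the self-adjoint part. The vector functionals
`a ↦ ⟪x, f a x⟫` of a σ-contractive representation are then weakly continuous of variation at most
`‖x‖²`, so that `‖f a‖ ≤ ‖a‖ₒ` and `f` extends to the completion; a positive functional `φ` extends
because `|φ a| ≤ v(φ) ‖a‖ₒ`.

On a C⋆-algebra, positive functionals are automatically continuous and the variation is the limit
of `φ (e⋆ e)` along an approximate unit, hence affine in `φ`, which makes the sets of states and
quasi-states convex. Finally, quasi-states are equicontinuous on the self-adjoint part of `C*(A)`,
in which `j(A_sa)` is dense, so convergence of quasi-states can be tested on `A`.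
-/

namespace EnvCStar

open Filter Topology

section Functionals

variable {A : Type*} [NonUnitalNormedRing A] [StarRing A] [NormedSpace ℂ A] {φ ψ : A →ₗ[ℂ] ℂ}

theorem IsPositive.re_nonneg (hφ : IsPositive φ) (a : A) : 0 ≤ (φ (star a * a)).re :=
  (Complex.le_def.1 (hφ a)).1

theorem IsPositive.add (hφ : IsPositive φ) (hψ : IsPositive ψ) : IsPositive (φ + ψ) :=
  fun a => add_nonneg (hφ a) (hψ a)

theorem IsPositive.smul (hφ : IsPositive φ) {r : ℝ} (hr : 0 ≤ r) : IsPositive (r • φ) :=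
  fun a => smul_nonneg hr (hφ a)

theorem variation_le_of_mem {v : ℝ} (hv : v ∈ variationBounds φ) : variation φ ≤ v :=
  csInf_le ⟨0, fun _ hw => hw.1⟩ hv

theorem weaklyContinuousOnSA_of_continuous (hφ : Continuous φ) : WeaklyContinuousOnSA φ :=
  fun b => by fun_prop

theorem IsQuasiState.one_mem_variationBounds (hφ : IsQuasiState φ) : 1 ∈ variationBounds φ :=
  ⟨zero_le_one, fun a =>
    ((mem_variationBounds hφ.positive hφ.finiteVariation).2 a).trans <|
      mul_le_mul_of_nonneg_right hφ.variation_le_one (hφ.positive.re_nonneg a)⟩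

theorem continuous_selfAdjoint_of_norm_le {E : Type*} [NormedAddCommGroup E] [NormedSpace ℂ E]
    {f : A →ₗ[ℂ] E} (hf : ∀ h, IsSelfAdjoint h → ‖f h‖ ≤ ‖h‖) :
    Continuous fun h : selfAdjoint A => f h :=
  AddMonoidHomClass.continuous_of_bound ((f : A →+ E).comp (selfAdjoint A).subtype) 1
    fun h => (hf h h.2).trans_eq (one_mul _).symm

end Functionals

section Pullback

variable {A : Type*} [NonUnitalNormedRing A] [StarRing A] [NormedSpace ℂ A]
  {B : Type*} [NonUnitalNormedRing B] [StarRing B] [NormedSpace ℂ B]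
  {f : A →⋆ₙₐ[ℂ] B} {φ : A →ₗ[ℂ] ℂ} {ψ : B →ₗ[ℂ] ℂ}

theorem IsPositive.comp (hψ : IsPositive ψ) (f : A →⋆ₙₐ[ℂ] B) :
    IsPositive (ψ ∘ₗ (f : A →ₗ[ℂ] B)) := fun a => by
  simpa [map_star] using hψ (f a)

theorem variationBounds_subset_comp (ψ : B →ₗ[ℂ] ℂ) (f : A →⋆ₙₐ[ℂ] B) :
    variationBounds ψ ⊆ variationBounds (ψ ∘ₗ (f : A →ₗ[ℂ] B)) :=
  fun _ hv => ⟨hv.1, fun a => by simpa [map_star] using hv.2 (f a)⟩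

theorem variation_comp_of_denseRange [ContinuousStar B] (hψ : Continuous ψ)
    (hf : DenseRange f) : variation (ψ ∘ₗ (f : A →ₗ[ℂ] B)) = variation ψ := by
  refine congrArg sInf ((variationBounds_subset_comp ψ f).antisymm' fun v hv => ⟨hv.1, fun b => ?_⟩)
  refine hf.induction_on (p := fun b => ‖ψ b‖ ^ 2 ≤ v * (ψ (star b * b)).re) b
    (isClosed_le (by fun_prop) (by fun_prop)) fun a => ?_
  simpa [map_star] using hv.2 a

theorem HasFiniteVariation.comp (hψ : HasFiniteVariation ψ) (f : A →⋆ₙₐ[ℂ] B) :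
    HasFiniteVariation (ψ ∘ₗ (f : A →ₗ[ℂ] B)) :=
  hψ.mono (variationBounds_subset_comp ψ f)

theorem WeaklyContinuousOnSA.comp (hψ : WeaklyContinuousOnSA ψ)
    (hf : Continuous fun h : selfAdjoint A => f h) :
    WeaklyContinuousOnSA (ψ ∘ₗ (f : A →ₗ[ℂ] B)) := fun b => by
  have h_comp : Continuous fun h : selfAdjoint A => ψ (star (f b) * f h * f b) :=
    (hψ (f b)).comp (hf.subtype_mk fun h => IsSelfAdjoint.map h.2 f)
  simpa [map_star] using h_comp

theorem IsQuasiState.comp (hψ : IsQuasiState ψ)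
    (hf : Continuous fun h : selfAdjoint A => f h) :
    IsQuasiState (ψ ∘ₗ (f : A →ₗ[ℂ] B)) where
  positive := hψ.positive.comp f
  weaklyContinuous := hψ.weaklyContinuous.comp hf
  finiteVariation := hψ.finiteVariation.comp f
  variation_le_one :=
    variation_le_of_mem (variationBounds_subset_comp ψ f hψ.one_mem_variationBounds)

theorem IsPositive.exists_comp_eq_of_norm_le [ContinuousStar B] (hφ : IsPositive φ)
    (hf : DenseRange f) {C : ℝ} (hC : ∀ a, ‖φ a‖ ≤ C * ‖f a‖) :
    ∃ ψ : B →ₗ[ℂ] ℂ, IsPositive ψ ∧ ψ ∘ₗ (f : A →ₗ[ℂ] B) = φ := by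
  let ψ := φ.extendOfNorm (f : A →ₗ[ℂ] B)
  have ψ_apply (a : A) : ψ (f a) = φ a := LinearMap.extendOfNorm_eq hf ⟨C, hC⟩ a
  refine ⟨ψ, fun b => ?_, LinearMap.ext ψ_apply⟩
  refine hf.induction_on (p := fun b => 0 ≤ ψ (star b * b)) b
    (isClosed_le (by fun_prop) (by fun_prop)) fun a => ?_
  rw [← map_star, ← map_mul, ψ_apply]
  exact hφ a

theorem setOf_isSelfAdjoint_subset_closure_image [StarModule ℂ A] [StarModule ℂ B]
    [ContinuousStar B] (hf : DenseRange f) :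
    {k : B | IsSelfAdjoint k} ⊆ closure (f '' {h : A | IsSelfAdjoint h}) := by
  intro k hk
  have half : IsSelfAdjoint (2⁻¹ : ℂ) := (IsSelfAdjoint.ofNat 2).inv₀
  have realPart_continuous : Continuous fun b : B => (2⁻¹ : ℂ) • (b + star b) := by fun_prop
  have realPart_eq : (2⁻¹ : ℂ) • (k + star k) = k := by
    rw [hk.star_eq, ← two_smul ℂ k, inv_smul_smul₀ two_ne_zero]
  have realPart_mem : Set.MapsTo (fun b : B => (2⁻¹ : ℂ) • (b + star b)) (Set.range f)
      (f '' {h : A | IsSelfAdjoint h}) := by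
    rintro _ ⟨a, rfl⟩
    exact ⟨(2⁻¹ : ℂ) • (a + star a), half.smul (.add_star_self a), by simp [map_star]⟩
  simpa only [realPart_eq] using map_mem_closure realPart_continuous (hf k) realPart_mem

end Pullback

section StarHomExtension

variable {A : Type*} [NonUnitalRing A] [Star A] [Module ℂ A]
  {B : Type*} [NonUnitalNormedRing B] [Star B] [ContinuousStar B] [NormedSpace ℂ B]
  {D : Type*} [NonUnitalNormedRing D] [Star D] [ContinuousStar D] [NormedSpace ℂ D]
  [CompleteSpace D]

theorem exists_starHom_comp_eq_of_norm_le {f : A →⋆ₙₐ[ℂ] B} (hf : DenseRange f)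
    (g : A →⋆ₙₐ[ℂ] D) {C : ℝ} (hC : ∀ a, ‖g a‖ ≤ C * ‖f a‖) :
    ∃ h : B →⋆ₙₐ[ℂ] D, h.comp f = g := by
  let h := (g : A →ₗ[ℂ] D).extendOfNorm (f : A →ₗ[ℂ] B)
  have h_apply (a : A) : h (f a) = g a := LinearMap.extendOfNorm_eq hf ⟨C, hC⟩ a
  have h_mul (b c : B) : h (b * c) = h b * h c :=
    hf.induction_on₂ (p := fun b c => h (b * c) = h b * h c)
      (isClosed_eq (by fun_prop) (by fun_prop))
      (fun x y => by rw [← map_mul, h_apply, h_apply, h_apply, map_mul]) b c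
  have h_star (b : B) : h (star b) = star (h b) :=
    hf.induction_on (p := fun b => h (star b) = star (h b)) b
      (isClosed_eq (by fun_prop) (by fun_prop))
      fun x => by rw [← map_star, h_apply, h_apply, map_star]
  exact ⟨{ (h : B →ₗ[ℂ] D) with
    map_zero' := map_zero h
    map_mul' := h_mul
    map_star' := h_star }, NonUnitalStarAlgHom.ext h_apply⟩

end StarHomExtension

section CStarAlgebra

open scoped CStarAlgebra in
theorem starHom_comp_injective {A : Type*} [NonUnitalRing A] [Star A] [Module ℂ A]
    {B D : Type*} [NonUnitalCStarAlgebra B] [NonUnitalCStarAlgebra D]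
    {f : A →⋆ₙₐ[ℂ] B} (hf : DenseRange f) :
    Function.Injective fun g : B →⋆ₙₐ[ℂ] D => g.comp f := fun g₁ g₂ h =>
  DFunLike.coe_injective <|
    hf.equalizer (map_continuous g₁) (map_continuous g₂) (congrArg DFunLike.coe h)

theorem exists_isApproximateUnit (B : Type*) [NonUnitalCStarAlgebra B] :
    ∃ l : Filter B, l.IsApproximateUnit ∧ ∀ᶠ e in l, IsSelfAdjoint e ∧ ‖e‖ ≤ 1 := by
  let _ := CStarAlgebra.spectralOrder B
  have := CStarAlgebra.spectralOrderedRing B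
  have hl := CStarAlgebra.increasingApproximateUnit B
  exact ⟨_, hl.toIsApproximateUnit, hl.eventually_isSelfAdjoint.and hl.eventually_norm⟩

theorem IsPositive.mem_variationBounds_of_frequently {A : Type*} [NonUnitalNormedRing A]
    [StarRing A] [NormedSpace ℂ A] [IsScalarTower ℂ A A] [SMulCommClass ℂ A A] [StarModule ℂ A]
    {φ : A →ₗ[ℂ] ℂ} (hφ : IsPositive φ) (hφc : Continuous φ) {l : Filter A}
    (hl : l.IsApproximateUnit) {c : ℝ}
    (hc : ∃ᶠ e in l, IsSelfAdjoint e ∧ (φ (star e * e)).re ≤ c) :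
    c ∈ variationBounds φ := by
  obtain ⟨e, -, he⟩ := hc.exists
  refine ⟨(hφ.re_nonneg e).trans he, fun a => ?_⟩
  have tendsto_mul : Tendsto (fun e => ‖φ (e * a)‖ ^ 2) l (𝓝 (‖φ a‖ ^ 2)) :=
    ((hφc.tendsto a).comp (hl.tendsto_mul_right a)).norm.pow 2
  refine le_of_tendsto_of_frequently tendsto_mul (hc.mono fun e ⟨he_sa, he_le⟩ => ?_)
  calc ‖φ (e * a)‖ ^ 2 = ‖φ (star e * a)‖ ^ 2 := by rw [he_sa.star_eq]
    _ ≤ (φ (star e * e)).re * (φ (star a * a)).re := form_cauchySchwarz hφ e a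
    _ ≤ c * (φ (star a * a)).re := mul_le_mul_of_nonneg_right he_le (hφ.re_nonneg a)

variable {B : Type*} [NonUnitalCStarAlgebra B] {φ ψ : B →ₗ[ℂ] ℂ}

theorem IsPositive.continuous (hφ : IsPositive φ) : Continuous φ := by
  let _ := CStarAlgebra.spectralOrder B
  have := CStarAlgebra.spectralOrderedRing B
  let φ' : B →ₚ[ℂ] ℂ := PositiveLinearMap.mk₀ φ fun x hx => by
    obtain ⟨y, rfl⟩ := CStarAlgebra.nonneg_iff_eq_star_mul_self.1 hx
    exact hφ y
  exact map_continuous φ'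

theorem IsPositive.weaklyContinuousOnSA (hφ : IsPositive φ) : WeaklyContinuousOnSA φ :=
  weaklyContinuousOnSA_of_continuous hφ.continuous

theorem norm_star_mul_self_le_one {e : B} (he : ‖e‖ ≤ 1) : ‖star e * e‖ ≤ 1 := by
  rw [CStarRing.norm_star_mul_self]
  exact mul_le_one₀ he (norm_nonneg e) he

theorem IsPositive.hasFiniteVariation (hφ : IsPositive φ) : HasFiniteVariation φ := by
  obtain ⟨l, hl, hl_unit⟩ := exists_isApproximateUnit B
  have := hl.neBot
  obtain ⟨C, hC, hφC⟩ := SemilinearMapClass.bound_of_continuous φ hφ.continuous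
  refine ⟨C, hφ.mem_variationBounds_of_frequently hφ.continuous hl
    (hl_unit.mono fun e he => ⟨he.1, ?_⟩).frequently⟩
  calc (φ (star e * e)).re ≤ ‖φ (star e * e)‖ := Complex.re_le_norm _
    _ ≤ C * ‖star e * e‖ := hφC _
    _ ≤ C := mul_le_of_le_one_right hC.le (norm_star_mul_self_le_one he.2)

theorem IsPositive.tendsto_variation (hφ : IsPositive φ) {l : Filter B}
    (hl : l.IsApproximateUnit) (hl_unit : ∀ᶠ e in l, IsSelfAdjoint e ∧ ‖e‖ ≤ 1) :
    Tendsto (fun e => (φ (star e * e)).re) l (𝓝 (variation φ)) := by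
  have hv := mem_variationBounds hφ hφ.hasFiniteVariation
  refine tendsto_order.2 ⟨fun c hc => ?_, fun c hc => ?_⟩
  · by_contra h
    have hle : ∃ᶠ e in l, (φ (star e * e)).re ≤ c := by
      simpa only [not_eventually, not_lt] using h
    exact hc.not_ge <| variation_le_of_mem <|
      hφ.mem_variationBounds_of_frequently hφ.continuous hl <|
        (hle.and_eventually hl_unit).mono fun e he => ⟨he.2.1, he.1⟩
  · filter_upwards [hl_unit] with e he
    calc (φ (star e * e)).re ≤ ‖φ (star e * e)‖ := Complex.re_le_norm _
      _ ≤ variation φ * ‖star e * e‖ :=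
        norm_le_of_isSelfAdjoint hφ hφ.weaklyContinuousOnSA hv _ (.star_mul_self e)
      _ ≤ variation φ := mul_le_of_le_one_right hv.1 (norm_star_mul_self_le_one he.2)
      _ < c := hc

theorem variation_add (hφ : IsPositive φ) (hψ : IsPositive ψ) :
    variation (φ + ψ) = variation φ + variation ψ := by
  obtain ⟨l, hl, hl_unit⟩ := exists_isApproximateUnit B
  have := hl.neBot
  refine tendsto_nhds_unique ((hφ.add hψ).tendsto_variation hl hl_unit) ?_
  simpa using (hφ.tendsto_variation hl hl_unit).add (hψ.tendsto_variation hl hl_unit)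

theorem variation_smul (hφ : IsPositive φ) {r : ℝ} (hr : 0 ≤ r) :
    variation (r • φ) = r * variation φ := by
  obtain ⟨l, hl, hl_unit⟩ := exists_isApproximateUnit B
  have := hl.neBot
  refine tendsto_nhds_unique ((hφ.smul hr).tendsto_variation hl hl_unit) ?_
  simpa using (hφ.tendsto_variation hl hl_unit).const_mul r

theorem convex_setOf_variation_mem {S : Set ℝ} (hS : Convex ℝ S) :
    Convex ℝ {φ : B →ₗ[ℂ] ℂ | IsPositive φ ∧ variation φ ∈ S} := by
  rintro φ ⟨hφ, hφS⟩ ψ ⟨hψ, hψS⟩ s t hs ht hst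
  refine ⟨(hφ.smul hs).add (hψ.smul ht), ?_⟩
  rw [variation_add (hφ.smul hs) (hψ.smul ht), variation_smul hφ hs, variation_smul hψ ht]
  exact hS hφS hψS hs ht hst

theorem isState_iff : IsState φ ↔ IsPositive φ ∧ variation φ = 1 :=
  ⟨fun h => ⟨h.positive, h.variation_eq_one⟩,
    fun h => ⟨h.1, h.1.weaklyContinuousOnSA, h.1.hasFiniteVariation, h.2⟩⟩

theorem isQuasiState_iff : IsQuasiState φ ↔ IsPositive φ ∧ variation φ ≤ 1 :=
  ⟨fun h => ⟨h.positive, h.variation_le_one⟩,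
    fun h => ⟨h.1, h.1.weaklyContinuousOnSA, h.1.hasFiniteVariation, h.2⟩⟩

end CStarAlgebra

section PtakFunction

theorem rLambda_le_norm {A : Type*} [NonUnitalNormedRing A] (a : A) : rLambda a ≤ ‖a‖ := by
  have h : BddBelow (Set.range fun n : ℕ => ‖(fun x => a * x)^[n] a‖ ^ ((1 : ℝ) / (n + 1))) :=
    ⟨0, by rintro _ ⟨n, rfl⟩; positivity⟩
  exact (ciInf_le h 0).trans_eq (by simp)

theorem isSelfAdjoint_iterate_mul {A : Type*} [NonUnitalRing A] [StarRing A] {h : A}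
    (hh : IsSelfAdjoint h) (n : ℕ) :
    IsSelfAdjoint ((fun x => h * x)^[n] h) ∧ Commute h ((fun x => h * x)^[n] h) := by
  induction n with
  | zero => exact ⟨hh, Commute.refl h⟩
  | succ n ih =>
    rw [Function.iterate_succ_apply']
    exact ⟨(hh.commute_iff ih.1).1 ih.2, (Commute.refl h).mul_right ih.2⟩

theorem norm_le_rLambda_of_isSelfAdjoint {B : Type*} [NonUnitalCStarAlgebra B] {x : B}
    (hx : IsSelfAdjoint x) : ‖x‖ ≤ rLambda x := by
  refine le_ciInf fun n => ?_
  let y : Unitization ℂ B := x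
  have pow_eq : (((fun z => x * z)^[n] x : B) : Unitization ℂ B) = y ^ (n + 1) := by
    rw [pow_succ, ← congrFun (mul_left_iterate y n) y]
    exact Function.Semiconj.iterate_right (fun z => Unitization.inr_mul ℂ x z) n x
  have h := spectrum.spectralRadius_le_pow_nnnorm_pow_one_div ℂ y n
  rw [(hx.inr ℂ).spectralRadius_eq_nnnorm, nnnorm_one, ENNReal.coe_one, ENNReal.one_rpow, mul_one,
    ← ENNReal.coe_rpow_of_nonneg _ (by positivity), ENNReal.coe_le_coe, ← pow_eq] at h
  simpa [Unitization.norm_inr] using NNReal.coe_le_coe.2 h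

theorem rSigma_le_norm_of_isSelfAdjoint {A : Type*} [NonUnitalNormedRing A] [StarRing A] {h : A}
    (hh : IsSelfAdjoint h) : rSigma h ≤ ‖h‖ := by
  refine Real.sqrt_le_iff.2 ⟨norm_nonneg h, (rLambda_le_norm _).trans ?_⟩
  rw [hh.star_eq, sq]
  exact norm_mul_le h h

variable {A : Type*} [NonUnitalNormedRing A] [StarRing A] [NormedSpace ℂ A]

theorem rLambda_map_le {B : Type*} [NonUnitalNormedRing B] [StarRing B] [NormedSpace ℂ B]
    {f : A →⋆ₙₐ[ℂ] B} (hf : ∀ h, IsSelfAdjoint h → ‖f h‖ ≤ ‖h‖) {h : A} (hh : IsSelfAdjoint h) :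
    rLambda (f h) ≤ rLambda h := by
  refine ciInf_mono ⟨0, by rintro _ ⟨n, rfl⟩; positivity⟩ fun n => ?_
  have map_iterate : f ((fun x => h * x)^[n] h) = (fun y => f h * y)^[n] (f h) :=
    Function.Semiconj.iterate_right (fun x => map_mul f h x) n h
  rw [← map_iterate]
  gcongr
  exact hf _ (isSelfAdjoint_iterate_mul hh n).1

theorem isSigmaContractive_iff {B : Type*} [NonUnitalCStarAlgebra B] {f : A →⋆ₙₐ[ℂ] B} :
    IsSigmaContractive (f : A →ₗ[ℂ] B) ↔ ∀ h, IsSelfAdjoint h → ‖f h‖ ≤ ‖h‖ := by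
  refine ⟨fun hf h hh => (hf h).trans (rSigma_le_norm_of_isSelfAdjoint hh),
    fun hf a => Real.le_sqrt_of_sq_le ?_⟩
  have ha : IsSelfAdjoint (star a * a) := .star_mul_self a
  calc ‖f a‖ ^ 2 = ‖f (star a * a)‖ := by
        rw [map_mul, map_star, CStarRing.norm_star_mul_self, sq]
    _ ≤ rLambda (f (star a * a)) := norm_le_rLambda_of_isSelfAdjoint (ha.map f)
    _ ≤ rLambda (star a * a) := rLambda_map_le hf ha

end PtakFunction

section Representations

variable {H : Type*} [NormedAddCommGroup H] [InnerProductSpace ℂ H]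

/-- The functional `T ↦ ⟪x, T x⟫` on the bounded operators of `H`; composed with a representation,
it yields the positive functionals through which norms in `H` are compared with `gnSeminorm`. -/
noncomputable def vectorFunctional (x : H) : (H →L[ℂ] H) →L[ℂ] ℂ :=
  (innerSL ℂ x).comp (ContinuousLinearMap.apply ℂ H x)

variable [CompleteSpace H]

theorem vectorFunctional_star_mul_self (x : H) (T : H →L[ℂ] H) :
    vectorFunctional x (star T * T) = ((‖T x‖ ^ 2 : ℝ) : ℂ) := by
  change inner ℂ x (ContinuousLinearMap.adjoint T (T x)) = _
  rw [ContinuousLinearMap.adjoint_inner_right, inner_self_eq_norm_sq_to_K]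
  norm_cast

theorem isPositive_vectorFunctional (x : H) :
    IsPositive (vectorFunctional x : (H →L[ℂ] H) →ₗ[ℂ] ℂ) := fun T =>
  (vectorFunctional_star_mul_self x T).symm ▸ Complex.zero_le_real.2 (sq_nonneg _)

theorem norm_sq_mem_variationBounds_vectorFunctional (x : H) :
    ‖x‖ ^ 2 ∈ variationBounds (vectorFunctional x : (H →L[ℂ] H) →ₗ[ℂ] ℂ) := by
  refine ⟨sq_nonneg _, fun T => ?_⟩
  calc ‖vectorFunctional x T‖ ^ 2 ≤ (‖x‖ * ‖T x‖) ^ 2 := by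
        gcongr
        exact norm_inner_le_norm x (T x)
    _ = ‖x‖ ^ 2 * (vectorFunctional x (star T * T)).re := by
        rw [vectorFunctional_star_mul_self, Complex.ofReal_re, mul_pow]

variable {A : Type*} [NonUnitalNormedRing A] [StarRing A] [NormedSpace ℂ A]

/-- A representation in a Hilbert space is the same as a `*`-homomorphism into the bounded
operators. -/
noncomputable def StarRep.equivStarHom : StarRep A H ≃ (A →⋆ₙₐ[ℂ] (H →L[ℂ] H)) where
  toFun π :=
    { π.op with
      map_zero' := map_zero π.op
      map_mul' := fun a b => ContinuousLinearMap.coe_injective (π.map_mul' a b)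
      map_star' := fun a => (ContinuousLinearMap.eq_adjoint_iff _ _).2 fun x y =>
        (π.inner_left (star a) x y).trans (by rw [star_star]; rfl) }
  invFun f :=
    { toFun := fun a => (f a : H →ₗ[ℂ] H)
      map_smul' := fun c a => by rw [map_smul]; rfl
      map_zero' := by rw [map_zero]; rfl
      map_add' := fun a b => by rw [map_add]; rfl
      map_mul' := fun a b => by rw [map_mul]; rfl
      inner_left := fun a x y => by
        rw [map_star]
        exact (ContinuousLinearMap.adjoint_inner_right (f a) x y).symm }
  left_inv _ := rfl
  right_inv _ := rfl

theorem StarRep.isSigmaContractive_equivStarHom_iff {π : StarRep A H} :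
    IsSigmaContractive (π.equivStarHom : A →ₗ[ℂ] (H →L[ℂ] H)) ↔ IsSigmaContractive π.op :=
  Iff.rfl

theorem StarRep.equivStarHom_comp {B : Type*} [NonUnitalNormedRing B] [StarRing B] [NormedSpace ℂ B]
    (π : StarRep B H) (f : A →⋆ₙₐ[ℂ] B) :
    (π.comp f).equivStarHom = π.equivStarHom.comp f :=
  rfl

end Representations

section Envelope

variable {A : Type u} [NonUnitalNormedRing A] [StarRing A] [NormedSpace ℂ A]
  [IsScalarTower ℂ A A] [SMulCommClass ℂ A A] [StarModule ℂ A]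

theorem gnSeminorm_le_norm_of_isSelfAdjoint {h : A} (hh : IsSelfAdjoint h) :
    gnSeminorm h ≤ ‖h‖ :=
  gn_le (norm_nonneg h) fun ψ => by
    simpa only [hh.star_eq, one_mul, sq] using form_le_of_isSelfAdjoint ψ.2.positive
      ψ.2.weaklyContinuous ψ.mem_variationBounds h hh

theorem norm_toCStarEnv_le_of_isSelfAdjoint {h : A} (hh : IsSelfAdjoint h) :
    ‖toCStarEnv A h‖ ≤ ‖h‖ :=
  (norm_toCStarEnv A h).trans_le (gnSeminorm_le_norm_of_isSelfAdjoint hh)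

variable (A) in
theorem continuous_toCStarEnv_selfAdjoint :
    Continuous fun h : selfAdjoint A => toCStarEnv A (h : A) :=
  continuous_selfAdjoint_of_norm_le (f := (toCStarEnv A : A →ₗ[ℂ] CStarEnv A))
    fun _ => norm_toCStarEnv_le_of_isSelfAdjoint

section Representations

variable {H : Type*} [NormedAddCommGroup H] [InnerProductSpace ℂ H] [CompleteSpace H]

theorem norm_apply_le_gnSeminorm {f : A →⋆ₙₐ[ℂ] (H →L[ℂ] H)}
    (hf : Continuous fun h : selfAdjoint A => f h) (a : A) : ‖f a‖ ≤ gnSeminorm a := by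
  refine (f a).opNorm_le_bound (gn_nonneg a) fun x => ?_
  have weaklyContinuous := weaklyContinuousOnSA_of_continuous
    (φ := (vectorFunctional x : (H →L[ℂ] H) →ₗ[ℂ] ℂ)) (vectorFunctional x).continuous
  have form_le : (vectorFunctional x (star (f a) * f a)).re ≤ ‖x‖ ^ 2 * gnSeminorm a ^ 2 := by
    simpa [map_star] using form_le_gn ((isPositive_vectorFunctional x).comp f)
      (weaklyContinuous.comp hf)
      (variationBounds_subset_comp _ f (norm_sq_mem_variationBounds_vectorFunctional x)) a
  refine le_of_sq_le_sq ?_ (mul_nonneg (gn_nonneg a) (norm_nonneg x))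
  calc ‖f a x‖ ^ 2 = (vectorFunctional x (star (f a) * f a)).re := by
        rw [vectorFunctional_star_mul_self, Complex.ofReal_re]
    _ ≤ ‖x‖ ^ 2 * gnSeminorm a ^ 2 := form_le
    _ = (gnSeminorm a * ‖x‖) ^ 2 := by ring

theorem bijOn_starHom_comp_toCStarEnv :
    Set.BijOn (fun g : CStarEnv A →⋆ₙₐ[ℂ] (H →L[ℂ] H) => g.comp (toCStarEnv A)) Set.univ
      {f | IsSigmaContractive (f : A →ₗ[ℂ] (H →L[ℂ] H))} := by
  refine ⟨fun g _ => isSigmaContractive_iff.2 fun h hh =>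
      (NonUnitalStarAlgHom.norm_apply_le g _).trans (norm_toCStarEnv_le_of_isSelfAdjoint hh),
    (starHom_comp_injective (denseRange_toCStarEnv A)).injOn, fun f hf => ?_⟩
  have continuous_f : Continuous fun h : selfAdjoint A => f h :=
    continuous_selfAdjoint_of_norm_le (f := (f : A →ₗ[ℂ] (H →L[ℂ] H)))
      (isSigmaContractive_iff.1 hf)
  have norm_f_le (a : A) : ‖f a‖ ≤ 1 * ‖toCStarEnv A a‖ := by
    rw [one_mul, norm_toCStarEnv]
    exact norm_apply_le_gnSeminorm continuous_f a
  obtain ⟨g, hg⟩ := exists_starHom_comp_eq_of_norm_le (denseRange_toCStarEnv A) f norm_f_le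
  exact ⟨g, trivial, hg⟩

theorem bijOn_starRep_comp_toCStarEnv :
    Set.BijOn (fun π₀ : StarRep (CStarEnv A) H => π₀.comp (toCStarEnv A)) Set.univ
      {π | IsSigmaContractive π.op} := by
  obtain ⟨mapsTo, injOn, surjOn⟩ := bijOn_starHom_comp_toCStarEnv (A := A) (H := H)
  refine ⟨fun π₀ _ => ?_, fun π₁ _ π₂ _ h => ?_, fun π hπ => ?_⟩
  · refine StarRep.isSigmaContractive_equivStarHom_iff.1 ?_
    rw [StarRep.equivStarHom_comp]
    exact mapsTo (Set.mem_univ π₀.equivStarHom)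
  · refine StarRep.equivStarHom.injective (injOn trivial trivial ?_)
    simpa only [StarRep.equivStarHom_comp] using congrArg StarRep.equivStarHom h
  · obtain ⟨g, -, hg⟩ := surjOn (StarRep.isSigmaContractive_equivStarHom_iff.2 hπ)
    refine ⟨StarRep.equivStarHom.symm g, trivial, StarRep.equivStarHom.injective ?_⟩
    rw [StarRep.equivStarHom_comp, Equiv.apply_symm_apply]
    exact hg

end Representations

section PositiveFunctionals

theorem IsPositive.norm_le_mul_gnSeminorm {φ : A →ₗ[ℂ] ℂ} (hφ : IsPositive φ)
    (hφw : WeaklyContinuousOnSA φ) {v : ℝ} (hv : v ∈ variationBounds φ) (a : A) :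
    ‖φ a‖ ≤ v * gnSeminorm a := by
  refine le_of_sq_le_sq ?_ (mul_nonneg hv.1 (gn_nonneg a))
  calc ‖φ a‖ ^ 2 ≤ v * (φ (star a * a)).re := hv.2 a
    _ ≤ v * (v * gnSeminorm a ^ 2) := mul_le_mul_of_nonneg_left (form_le_gn hφ hφw hv a) hv.1
    _ = (v * gnSeminorm a) ^ 2 := by ring

variable (A) in
theorem bijOn_isPositive_comp_toCStarEnv :
    Set.BijOn (fun φ₀ : CStarEnv A →ₗ[ℂ] ℂ => φ₀ ∘ₗ (toCStarEnv A : A →ₗ[ℂ] CStarEnv A))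
      {φ₀ | IsPositive φ₀}
      {φ | IsPositive φ ∧ HasFiniteVariation φ ∧ WeaklyContinuousOnSA φ} := by
  refine ⟨fun φ₀ (hφ₀ : IsPositive φ₀) => ⟨hφ₀.comp _, hφ₀.hasFiniteVariation.comp _,
      hφ₀.weaklyContinuousOnSA.comp (continuous_toCStarEnv_selfAdjoint A)⟩,
    fun φ₁ (hφ₁ : IsPositive φ₁) φ₂ (hφ₂ : IsPositive φ₂) h => ?_,
    fun φ ⟨hφ, hφv, hφw⟩ => ?_⟩
  · exact DFunLike.coe_injective <|
      (denseRange_toCStarEnv A).equalizer hφ₁.continuous hφ₂.continuous (congrArg DFunLike.coe h)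
  · refine hφ.exists_comp_eq_of_norm_le (denseRange_toCStarEnv A) (C := variation φ) fun a => ?_
    rw [norm_toCStarEnv]
    exact hφ.norm_le_mul_gnSeminorm hφw (mem_variationBounds hφ hφv) a

theorem variation_comp_toCStarEnv {φ₀ : CStarEnv A →ₗ[ℂ] ℂ} (hφ₀ : IsPositive φ₀) :
    variation (φ₀ ∘ₗ (toCStarEnv A : A →ₗ[ℂ] CStarEnv A)) = variation φ₀ :=
  variation_comp_of_denseRange hφ₀.continuous (denseRange_toCStarEnv A)

theorem isState_comp_toCStarEnv_iff {φ₀ : CStarEnv A →ₗ[ℂ] ℂ} (hφ₀ : IsPositive φ₀) :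
    IsState (φ₀ ∘ₗ (toCStarEnv A : A →ₗ[ℂ] CStarEnv A)) ↔ IsState φ₀ := by
  obtain ⟨hφ, hφv, hφw⟩ := (bijOn_isPositive_comp_toCStarEnv A).mapsTo hφ₀
  rw [isState_iff, ← variation_comp_toCStarEnv hφ₀]
  exact ⟨fun h => ⟨hφ₀, h.variation_eq_one⟩, fun h => ⟨hφ, hφw, hφv, h.2⟩⟩

theorem isQuasiState_comp_toCStarEnv_iff {φ₀ : CStarEnv A →ₗ[ℂ] ℂ} (hφ₀ : IsPositive φ₀) :
    IsQuasiState (φ₀ ∘ₗ (toCStarEnv A : A →ₗ[ℂ] CStarEnv A)) ↔ IsQuasiState φ₀ := by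
  obtain ⟨hφ, hφv, hφw⟩ := (bijOn_isPositive_comp_toCStarEnv A).mapsTo hφ₀
  rw [isQuasiState_iff, ← variation_comp_toCStarEnv hφ₀]
  exact ⟨fun h => ⟨hφ₀, h.variation_le_one⟩, fun h => ⟨hφ, hφw, hφv, h.2⟩⟩

variable (A)

theorem bijOn_isState_comp_toCStarEnv :
    Set.BijOn (fun φ₀ : CStarEnv A →ₗ[ℂ] ℂ => φ₀ ∘ₗ (toCStarEnv A : A →ₗ[ℂ] CStarEnv A))
      {φ₀ | IsState φ₀} {φ | IsState φ} := by
  convert (bijOn_isPositive_comp_toCStarEnv A).subset_right (r := {φ | IsState φ})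
    fun φ hφ => ⟨hφ.positive, hφ.finiteVariation, hφ.weaklyContinuous⟩ using 1
  ext φ₀
  exact ⟨fun h => ⟨h.positive, (isState_comp_toCStarEnv_iff h.positive).2 h⟩,
    fun h => (isState_comp_toCStarEnv_iff h.1).1 h.2⟩

theorem bijOn_isQuasiState_comp_toCStarEnv :
    Set.BijOn (fun φ₀ : CStarEnv A →ₗ[ℂ] ℂ => φ₀ ∘ₗ (toCStarEnv A : A →ₗ[ℂ] CStarEnv A))
      {φ₀ | IsQuasiState φ₀} {φ | IsQuasiState φ} := by
  convert (bijOn_isPositive_comp_toCStarEnv A).subset_right (r := {φ | IsQuasiState φ})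
    fun φ hφ => ⟨hφ.positive, hφ.finiteVariation, hφ.weaklyContinuous⟩ using 1
  ext φ₀
  exact ⟨fun h => ⟨h.positive, (isQuasiState_comp_toCStarEnv_iff h.positive).2 h⟩,
    fun h => (isQuasiState_comp_toCStarEnv_iff h.1).1 h.2⟩

theorem convex_setOf_isState : Convex ℝ {φ : A →ₗ[ℂ] ℂ | IsState φ} := by
  rw [← (bijOn_isState_comp_toCStarEnv A).image_eq]
  refine Convex.is_linear_image ?_ ⟨fun _ _ => rfl, fun _ _ => rfl⟩
  have setOf_eq : {φ₀ : CStarEnv A →ₗ[ℂ] ℂ | IsState φ₀} =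
      {φ₀ | IsPositive φ₀ ∧ variation φ₀ ∈ ({1} : Set ℝ)} :=
    Set.ext fun _ => isState_iff
  exact setOf_eq ▸ convex_setOf_variation_mem (convex_singleton 1)

theorem convex_setOf_isQuasiState : Convex ℝ {φ : A →ₗ[ℂ] ℂ | IsQuasiState φ} := by
  rw [← (bijOn_isQuasiState_comp_toCStarEnv A).image_eq]
  refine Convex.is_linear_image ?_ ⟨fun _ _ => rfl, fun _ _ => rfl⟩
  have setOf_eq : {φ₀ : CStarEnv A →ₗ[ℂ] ℂ | IsQuasiState φ₀} =
      {φ₀ | IsPositive φ₀ ∧ variation φ₀ ∈ Set.Iic 1} :=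
    Set.ext fun _ => isQuasiState_iff
  exact setOf_eq ▸ convex_setOf_variation_mem (convex_Iic 1)

end PositiveFunctionals

end Envelope

section StateSpaces

variable {A : Type u} [NonUnitalNormedRing A] [StarRing A] [NormedSpace ℂ A]
  [IsScalarTower ℂ A A] [SMulCommClass ℂ A A] [StarModule ℂ A]
  {B : Type v} [NonUnitalNormedRing B] [StarRing B] [NormedSpace ℂ B]
  [IsScalarTower ℂ B B] [SMulCommClass ℂ B B] [StarModule ℂ B]
  {X : Type*} [TopologicalSpace X]

theorem QuasiState.continuous_iff {g : X → QuasiState A} :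
    Continuous g ↔ ∀ h, IsSelfAdjoint h → Continuous fun x => ((g x).1 h).re := by
  rw [continuous_induced_rng]
  exact ⟨fun hg h hh => (WeakDual.eval_continuous (⟨h, hh⟩ : selfAdjoint A)).comp hg, fun hg =>
    WeakDual.continuous_of_continuous_eval (g := fun x => (g x).toWeakDual) fun h => hg h h.2⟩

theorem QuasiState.norm_apply_le (φ : QuasiState A) {h : A} (hh : IsSelfAdjoint h) :
    ‖φ.1 h‖ ≤ ‖h‖ := by
  simpa only [one_mul] using norm_le_of_isSelfAdjoint φ.2.positive φ.2.weaklyContinuous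
    φ.2.one_mem_variationBounds h hh

/-- The pullback `φ ↦ φ ∘ f` of quasi-states along a `*`-homomorphism `f` that is continuous on
the self-adjoint part. -/
def QuasiState.comap (f : A →⋆ₙₐ[ℂ] B) (hf : Continuous fun h : selfAdjoint A => f h)
    (φ : QuasiState B) : QuasiState A :=
  ⟨φ.1 ∘ₗ (f : A →ₗ[ℂ] B), φ.2.comp hf⟩

variable {f : A →⋆ₙₐ[ℂ] B} {hf : Continuous fun h : selfAdjoint A => f h}

theorem QuasiState.continuous_comap : Continuous (comap f hf) :=
  continuous_iff.2 fun _ hh => continuous_iff.1 continuous_id _ (hh.map f)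

theorem QuasiState.continuous_of_continuous_comap [ContinuousStar B] (hf_dense : DenseRange f)
    {g : X → QuasiState B} (hg : Continuous fun x => comap f hf (g x)) : Continuous g := by
  refine continuous_iff.2 fun k hk => continuous_of_uniform_approx_of_continuous fun U hU => ?_
  obtain ⟨ε, hε, hεU⟩ := Metric.mem_uniformity_dist.1 hU
  obtain ⟨_, ⟨h, hh, rfl⟩, dist_lt⟩ := Metric.mem_closure_iff.1
    (setOf_isSelfAdjoint_subset_closure_image hf_dense hk) ε hε
  refine ⟨fun x => ((g x).1 (f h)).re, continuous_iff.1 hg h hh, fun x => hεU ?_⟩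
  calc dist ((g x).1 k).re ((g x).1 (f h)).re = |((g x).1 (k - f h)).re| := by
        rw [Real.dist_eq, map_sub, Complex.sub_re]
    _ ≤ ‖(g x).1 (k - f h)‖ := Complex.abs_re_le_norm _
    _ ≤ ‖k - f h‖ := (g x).norm_apply_le (hk.sub (hh.map f))
    _ < ε := by rwa [← dist_eq_norm]

variable (A) in
/-- The pullback along `j : A → C*(A)`, as a homeomorphism from `QS(C*(A))` onto `QS(A)`. -/
noncomputable def quasiStateHomeomorph : QuasiState (CStarEnv A) ≃ₜ QuasiState A :=
  let e : QuasiState (CStarEnv A) ≃ QuasiState A :=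
    (bijOn_isQuasiState_comp_toCStarEnv A).equiv _
  { e with
    continuous_toFun :=
      QuasiState.continuous_comap (hf := continuous_toCStarEnv_selfAdjoint A)
    continuous_invFun :=
      QuasiState.continuous_of_continuous_comap (hf := continuous_toCStarEnv_selfAdjoint A)
        (denseRange_toCStarEnv A) (continuous_id.congr fun φ => (e.apply_symm_apply φ).symm) }

theorem mem_stateSet_iff_quasiStateHomeomorph (φ₀ : QuasiState (CStarEnv A)) :
    φ₀ ∈ stateSet (CStarEnv A) ↔ quasiStateHomeomorph A φ₀ ∈ stateSet A :=
  (isState_comp_toCStarEnv_iff φ₀.2.positive).symm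

end StateSpaces

end EnvCStar

open EnvCStar in
theorem mainTheorem4 (A : Type u) [NonUnitalNormedRing A] [StarRing A] [NormedSpace ℂ A]
    [IsScalarTower ℂ A A] [SMulCommClass ℂ A A] [StarModule ℂ A] :
    -- representations
    (∀ (H : Type v) [NormedAddCommGroup H] [InnerProductSpace ℂ H] [CompleteSpace H],
      Set.BijOn (fun π₀ : StarRep (CStarEnv A) H => π₀.comp (toCStarEnv A))
        Set.univ {π : StarRep A H | IsSigmaContractive π.op}) ∧
    -- positive functionals
    (Set.BijOn
        (fun φ₀ : CStarEnv A →ₗ[ℂ] ℂ => φ₀ ∘ₗ (toCStarEnv A : A →ₗ[ℂ] CStarEnv A))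
        {φ₀ | IsPositive φ₀}
        {φ : A →ₗ[ℂ] ℂ | IsPositive φ ∧ HasFiniteVariation φ ∧ WeaklyContinuousOnSA φ} ∧
      ∀ φ₀ : CStarEnv A →ₗ[ℂ] ℂ, IsPositive φ₀ →
        HasFiniteVariation φ₀ ∧
        variation (φ₀ ∘ₗ (toCStarEnv A : A →ₗ[ℂ] CStarEnv A)) = variation φ₀) ∧
    -- quasi-states and states
    (Convex ℝ {φ₀ : CStarEnv A →ₗ[ℂ] ℂ | IsQuasiState φ₀} ∧
      Convex ℝ {φ : A →ₗ[ℂ] ℂ | IsQuasiState φ} ∧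
      Convex ℝ {φ₀ : CStarEnv A →ₗ[ℂ] ℂ | IsState φ₀} ∧
      Convex ℝ {φ : A →ₗ[ℂ] ℂ | IsState φ} ∧
      ∃ Φ : QuasiState (CStarEnv A) ≃ₜ QuasiState A,
        (∀ φ₀ : QuasiState (CStarEnv A),
          (Φ φ₀).1 = φ₀.1 ∘ₗ (toCStarEnv A : A →ₗ[ℂ] CStarEnv A)) ∧
        (∀ (φ₁ φ₂ φ₃ : QuasiState (CStarEnv A)) (s t : ℝ), 0 ≤ s → 0 ≤ t → s + t = 1 →
          φ₃.1 = s • φ₁.1 + t • φ₂.1 → (Φ φ₃).1 = s • (Φ φ₁).1 + t • (Φ φ₂).1) ∧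
        ∃ Ψ : stateSet (CStarEnv A) ≃ₜ stateSet A,
          ∀ ψ₀ : stateSet (CStarEnv A), (Ψ ψ₀ : QuasiState A) = Φ ψ₀) := by
  refine ⟨fun H _ _ _ => bijOn_starRep_comp_toCStarEnv,
    ⟨bijOn_isPositive_comp_toCStarEnv A,
      fun φ₀ hφ₀ => ⟨hφ₀.hasFiniteVariation, variation_comp_toCStarEnv hφ₀⟩⟩,
    convex_setOf_isQuasiState _, convex_setOf_isQuasiState A,
    convex_setOf_isState _, convex_setOf_isState A,
    quasiStateHomeomorph A, fun _ => rfl, fun φ₁ φ₂ φ₃ s t _ _ _ h => ?_,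
    (quasiStateHomeomorph A).subtype mem_stateSet_iff_quasiStateHomeomorph, fun _ => rfl⟩
  exact congrArg (· ∘ₗ (toCStarEnv A : A →ₗ[ℂ] CStarEnv A)) h
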